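/- Let $p \ge 1$, let $\theta = (\theta_1,\dots,\theta_p)' \in \mathbb{R}^p$ be a nonzero vector with $\|\theta\|_1 = \sum_{i=1}^p |\theta_i| < 1$, and let $\rho \in \mathbb{R}$ with $|\rho| < 1$. Let $(V_n)_{n\ge 1}$ be independent and identically distributed square-integrable real random variables with mean $0$ and variance $\sigma^2$, where $\sigma > 0$, and let $X_0$ be a square-integrable random variable on the same probability space. Consider the process given by $\varepsilon_0 = X_0$, $X_{-1} = \dots = X_{-p} = 0$ and, for all $n \ge 1$, $$X_n = \theta_1 X_{n-1} + \dots + \theta_p X_{n-p} + \varepsilon_n, \qquad \varepsilon_n = \rho\,\varepsilon_{n-1} + V_n .$$ Let $\Phi_n = (X_n, X_{n-1}, \dots, X_{n-p+1})'$, let $S$ be a fixed symmetric positive definite $p\times p$ real matrix, and put $S_n = \sum_{k=0}^n \Phi_k \Phi_k' + S$. For $n\ge 1$ define the least squares estimator $$\widehat\theta_n = S_{n-1}^{-1} \sum_{k=1}^n \Phi_{k-1} X_k ,$$ with $p$-th component $\widehat\theta_{p,n}$, the residuals $\widehat\varepsilon_0 = X_0$ and $\widehat\varepsilon_k = X_k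 - \widehat\theta_n'\,\Phi_{k-1}$ for $1\le k\le n$, and the estimators $$\widehat\rho_n = \Big(\sum_{k=1}^n \widehat\varepsilon_{k-1}^{\,2}\Big)^{-1} \sum_{k=1}^n \widehat\varepsilon_k\,\widehat\varepsilon_{k-1}, \qquad \widehat\sigma_n^{\,2} = \Big(1 - \widehat\rho_n^{\,2}\,\widehat\theta_{p,n}^{\,-2}\Big)\frac1n \sum_{k=0}^n \widehat\varepsilon_k^{\,2}.$$ Let $\theta^* = \alpha\,(I_p - \theta_p\rho J_p)\,\beta$, where $I_p$ is the identity matrix of order $p$, $J_p$ is the exchange matrix of order $p$ (ones on the antidiagonal and zeros elsewhere), $\alpha = \frac{1}{(1-\theta_p\rho)(1+\theta_p\rho)}$ and $\beta = (\theta_1+\rho,\ \theta_2-\theta_1\rho,\ \dots,\ \theta_p-\theta_{p-1}\rho)'$. Assume that the $p$-th component $\theta_p^*$ of $\theta^*$ is nonzero. Then, almost surely, the denominators $\sum_{k=1}^n \widehat\varepsilon_{k-1}^{\,2}$ and $\widehat\theta_{p,n}$ are nonzero for all sufficiently large $n$ (so that $\widehat\sigma_n^{\,2}$ is well defined), and $$\lim_{n\to\infty}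 \widehat\sigma_n^{\,2} = \sigma^2 .$$ -/

import Mathlib

open MeasureTheory ProbabilityTheory Filter Topology
open scoped Matrix

noncomputable section

namespace DurbinWatson

/-- The index of the `p`-th (last) component of a `p`-dimensional vector. -/
def lastIndex {p : ℕ} (hp : 1 ≤ p) : Fin p := ⟨p - 1, Nat.sub_lt hp one_pos⟩

/-- The process `(X_n)` is the `p`-order autoregressive process
`X_n = θ_1 X_{n-1} + ⋯ + θ_p X_{n-p} + ε_n` driven by `ε_n = ρ ε_{n-1} + V_n`, for all `n ≥ 1`,
with initial values `X_0 = ε_0` and `X_{-1} = ⋯ = X_{-p} = 0`.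
The coordinate `θ i` with `i : Fin p` is the coefficient `θ_{i+1}`. -/
structure IsARProcess {Ω : Type*} {p : ℕ} (θ : Fin p → ℝ) (ρ : ℝ)
    (X : ℤ → Ω → ℝ) (ε V : ℕ → Ω → ℝ) : Prop where
  ar_eq : ∀ n : ℕ, 1 ≤ n → ∀ ω,
    X (n : ℤ) ω = ∑ i : Fin p, θ i * X ((n : ℤ) - ((i : ℕ) : ℤ) - 1) ω + ε n ω
  noise_eq : ∀ n : ℕ, 1 ≤ n → ∀ ω, ε n ω = ρ * ε (n - 1) ω + V n ω
  init_zero : ∀ ω, X 0 ω = ε 0 ω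
  init_neg : ∀ j : ℕ, 1 ≤ j → j ≤ p → ∀ ω, X (-(j : ℤ)) ω = 0

/-- The exchange matrix `J_p`. -/
def exchangeMatrix (p : ℕ) : Matrix (Fin p) (Fin p) ℝ :=
  Matrix.of fun i j => if j = Fin.rev i then 1 else 0

/-- `α = 1 / ((1 - θ_p ρ) (1 + θ_p ρ))`. -/
def alpha {p : ℕ} (hp : 1 ≤ p) (θ : Fin p → ℝ) (ρ : ℝ) : ℝ :=
  1 / ((1 - θ (lastIndex hp) * ρ) * (1 + θ (lastIndex hp) * ρ))

/-- `β = (θ_1 + ρ, θ_2 - θ_1 ρ, …, θ_p - θ_{p-1} ρ)'`. -/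
def beta {p : ℕ} (θ : Fin p → ℝ) (ρ : ℝ) : Fin p → ℝ := fun i =>
  if (i : ℕ) = 0 then θ i + ρ
  else θ i - θ ⟨(i : ℕ) - 1, lt_of_le_of_lt (Nat.sub_le _ _) i.isLt⟩ * ρ

/-- The limiting value `θ* = α (I_p - θ_p ρ J_p) β`. -/
def thetaStar {p : ℕ} (hp : 1 ≤ p) (θ : Fin p → ℝ) (ρ : ℝ) : Fin p → ℝ :=
  alpha hp θ ρ • ((1 - (θ (lastIndex hp) * ρ) • exchangeMatrix p) *ᵥ beta θ ρ)

/-! The estimators below are functions of an observed path `x : ℤ → ℝ`. -/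

/-- The lag vector `Φ_k = (x_k, x_{k-1}, …, x_{k-p+1})'`. -/
def lagVector (p : ℕ) (x : ℤ → ℝ) (k : ℤ) : Fin p → ℝ := fun i => x (k - ((i : ℕ) : ℤ))

/-- `S_n = ∑_{k=0}^n Φ_k Φ_k' + S`. -/
def designMatrix {p : ℕ} (S : Matrix (Fin p) (Fin p) ℝ) (x : ℤ → ℝ) (n : ℕ) :
    Matrix (Fin p) (Fin p) ℝ :=
  ∑ k ∈ Finset.range (n + 1),
    Matrix.vecMulVec (lagVector p x (k : ℤ)) (lagVector p x (k : ℤ)) + S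

/-- The least squares estimator `θ̂_n = (S_{n-1})⁻¹ ∑_{k=1}^n Φ_{k-1} x_k`, for `n ≥ 1`. -/
def thetaHat {p : ℕ} (S : Matrix (Fin p) (Fin p) ℝ) (x : ℤ → ℝ) (n : ℕ) : Fin p → ℝ :=
  (designMatrix S x (n - 1))⁻¹ *ᵥ
    ∑ k ∈ Finset.Icc 1 n, x (k : ℤ) • lagVector p x ((k : ℤ) - 1)

/-- The residuals at stage `n`: `ε̂_0 = x_0` and `ε̂_k = x_k - θ̂_n' Φ_{k-1}` for `1 ≤ k ≤ n`. -/
def residual {p : ℕ} (S : Matrix (Fin p) (Fin p) ℝ) (x : ℤ → ℝ) (n k : ℕ) : ℝ :=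
  if k = 0 then x 0
  else x (k : ℤ) - thetaHat S x n ⬝ᵥ lagVector p x ((k : ℤ) - 1)

/-- The serial correlation estimator
`ρ̂_n = (∑_{k=1}^n ε̂_{k-1}²)⁻¹ ∑_{k=1}^n ε̂_k ε̂_{k-1}`, for `n ≥ 1`. -/
def rhoHat {p : ℕ} (S : Matrix (Fin p) (Fin p) ℝ) (x : ℤ → ℝ) (n : ℕ) : ℝ :=
  (∑ k ∈ Finset.Icc 1 n, residual S x n (k - 1) ^ 2)⁻¹ *
    ∑ k ∈ Finset.Icc 1 n, residual S x n k * residual S x n (k - 1)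

/-- The variance estimator
`σ̂_n² = (1 - ρ̂_n² θ̂_{p,n}⁻²) (1/n) ∑_{k=0}^n ε̂_k²`, for `n ≥ 1`. -/
def sigmaSqHat {p : ℕ} (hp : 1 ≤ p) (S : Matrix (Fin p) (Fin p) ℝ) (x : ℤ → ℝ) (n : ℕ) : ℝ :=
  (1 - rhoHat S x n ^ 2 * (thetaHat S x n (lastIndex hp) ^ 2)⁻¹) *
    ((1 / (n : ℝ)) * ∑ k ∈ Finset.range (n + 1), residual S x n k ^ 2)

end DurbinWatson

end

/-! Write `z` for the lag operator, `Q = 1 - ∑ θ_i z^i`, `P = 1 - ρ z` and `c = θ_p ρ`. With `X_0`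
counted as the innovation at time 0, the path is the filter `ψ = (QP)⁻¹` applied to the innovations,
and `‖θ‖₁ < 1`, `|ρ| < 1` make `ψ` absolutely summable. By the strong law the innovations have the
sample autocovariances of white noise (`ae_tendsto_average_mul_lag`), so those of the lagged paths
converge to `σ²` times the `ℓ²` inner products of `T i = z^i ψ` (`tendsto_average_filter_mul`). What
remains is Hilbert space geometry.

Since `QP = 1 - ∑ β_i z^i + c z^(p+1)` and `β = θ* + c J θ*`, the unit vector `e = QPψ` equals `F +
c B`, with `F` and `B` the forward and backward residuals of `T` for the coefficients `θ*`. As `e`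
is orthogonal to `T 1, T 2, …` and time reversal exchanges `F` and `B`, one gets `F ⟂ T 1, …, T p`,
whence `θ̂_n → θ*`, as well as `‖e‖² = (1 - c²)‖F‖²` and `⟨F, zF⟩ = c θ*_p ‖F‖²`. So `ρ̂_n → c
θ*_p`, the correcting factor tends to `1 - c²`, the mean squared residual to `σ²‖F‖²`, and their
product to `σ²‖e‖² = σ²`. -/

namespace DurbinWatson

/-! ### Sample covariances of absolutely summable filters of white noise -/

open PowerSeries in
/-- Sample second moments of two lagged copies of a sequence whose sample autocovariances converge
to those of white noise. -/
theorem tendsto_average_lag_mul {v : ℕ → ℝ} {s : ℝ}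
    (hv : ∀ h : ℕ, Tendsto (fun n : ℕ => (n : ℝ)⁻¹ * ∑ k ∈ Finset.range n, v k * v (k + h)) atTop
      (𝓝 (if h = 0 then s else 0))) (i j : ℕ) :
    Tendsto (fun n : ℕ => (n : ℝ)⁻¹ * ∑ k ∈ Finset.range n,
      (if i ≤ k then v (k - i) else 0) * (if j ≤ k then v (k - j) else 0)) atTop
      (𝓝 (if i = j then s else 0)) := by
  wlog hij : i ≤ j generalizing i j
  · have := this j i (by omega)
    simp only [eq_comm (a := j)] at this
    simpa only [mul_comm (ite (j ≤ _) _ _)] using this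
  obtain ⟨h, rfl⟩ := Nat.exists_eq_add_of_le hij
  -- The zero padding kills the first `i + h` terms; what is left is exactly the lag-`h` sum.
  have key : ∀ n, ∑ k ∈ Finset.range (n + (i + h)),
      (if i ≤ k then v (k - i) else 0) * (if i + h ≤ k then v (k - (i + h)) else 0)
      = ∑ k ∈ Finset.range n, v k * v (k + h) := by
    intro n
    rw [add_comm n, Finset.sum_range_add, Finset.sum_eq_zero, zero_add]
    · refine Finset.sum_congr rfl fun k _ => ?_
      rw [if_pos (by omega), if_pos (by omega), mul_comm]
      congr 2 <;> omega
    · intro k hk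
      rw [Finset.mem_range] at hk
      rw [if_neg (by omega : ¬ i + h ≤ k), mul_zero]
  rw [← tendsto_add_atTop_iff_nat (i + h)]
  simp only [key]
  have h1 : Tendsto (fun n : ℕ => (n : ℝ) / ((n : ℝ) + ((i + h : ℕ) : ℝ))) atTop (𝓝 1) :=
    tendsto_natCast_div_add_atTop _
  have h2 := h1.mul (hv h)
  have h3 : (i = i + h) ↔ h = 0 := by omega
  simp only [h3, one_mul] at h2 ⊢
  refine h2.congr' ?_
  filter_upwards [eventually_gt_atTop 0] with n hn
  have : (n : ℝ) ≠ 0 := by positivity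
  push_cast
  field_simp

theorem sum_range_lag_sq_le (v : ℕ → ℝ) (i n : ℕ) :
    ∑ k ∈ Finset.range n, (if i ≤ k then v (k - i) else 0) ^ 2 ≤ ∑ k ∈ Finset.range n, v k ^ 2 := by
  rcases le_total n i with h | h
  · rw [Finset.sum_eq_zero]
    · exact Finset.sum_nonneg fun _ _ => sq_nonneg _
    · intro k hk
      rw [Finset.mem_range] at hk
      rw [if_neg (by omega)]; simp
  · obtain ⟨m, rfl⟩ := Nat.exists_eq_add_of_le h
    rw [Finset.sum_range_add, Finset.sum_eq_zero, zero_add]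
    · refine le_trans (le_of_eq ?_) (Finset.sum_le_sum_of_subset_of_nonneg
        (Finset.range_mono (Nat.le_add_left m i)) fun _ _ _ => sq_nonneg _)
      refine Finset.sum_congr rfl fun k _ => ?_
      rw [if_pos (by omega)]
      congr 2; omega
    · intro k hk
      rw [Finset.mem_range] at hk
      rw [if_neg (by omega)]; simp

/-- By `|ab| ≤ (a² + b²)/2`. Uniformity in both lags and in `n` supplies the dominating function for
passing to the limit in the filter expansion. -/
theorem abs_average_lag_mul_le {v : ℕ → ℝ} {C : ℝ}
    (hC : ∀ n : ℕ, (n : ℝ)⁻¹ * ∑ k ∈ Finset.range n, v k ^ 2 ≤ C) (i j n : ℕ) :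
    |(n : ℝ)⁻¹ * ∑ k ∈ Finset.range n,
      (if i ≤ k then v (k - i) else 0) * (if j ≤ k then v (k - j) else 0)| ≤ C := by
  refine le_trans ?_ (hC n)
  rw [abs_mul, abs_of_nonneg (by positivity : (0 : ℝ) ≤ (n : ℝ)⁻¹)]
  refine mul_le_mul_of_nonneg_left ?_ (by positivity)
  have hi := sum_range_lag_sq_le v i n
  have hj := sum_range_lag_sq_le v j n
  have : ∑ k ∈ Finset.range n, |(if i ≤ k then v (k - i) else 0) *
      (if j ≤ k then v (k - j) else 0)| ≤ ∑ k ∈ Finset.range n,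
      ((if i ≤ k then v (k - i) else 0) ^ 2 + (if j ≤ k then v (k - j) else 0) ^ 2) / 2 := by
    refine Finset.sum_le_sum fun k _ => ?_
    rw [abs_mul]
    nlinarith [sq_nonneg (|if i ≤ k then v (k - i) else 0| - |if j ≤ k then v (k - j) else 0|),
      sq_abs (if i ≤ k then v (k - i) else 0), sq_abs (if j ≤ k then v (k - j) else 0)]
  rw [← Finset.sum_div, Finset.sum_add_distrib] at this
  exact (Finset.abs_sum_le_sum_abs _ _).trans (by linarith)

theorem coeff_mul_eq_sum_lag (f v : PowerSeries ℝ) {k n : ℕ} (hk : k < n) :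
    PowerSeries.coeff k (f * v) = ∑ i ∈ Finset.range n,
      PowerSeries.coeff i f * (if i ≤ k then PowerSeries.coeff (k - i) v else 0) := by
  rw [PowerSeries.coeff_mul, Finset.Nat.sum_antidiagonal_eq_sum_range_succ
    (fun i j => PowerSeries.coeff i f * PowerSeries.coeff j v)]
  have hs : Finset.range k.succ ⊆ Finset.range n := Finset.range_mono hk
  rw [← Finset.sum_subset hs]
  · refine Finset.sum_congr rfl fun i hi => ?_
    rw [Finset.mem_range] at hi
    rw [if_pos (by omega)]
  · intro i _ hi
    rw [Finset.mem_range] at hi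
    rw [if_neg (by omega), mul_zero]

/-- Sample second moments of two filtered sequences converge to the `ℓ²` pairing of the filters when
the input behaves like white noise of variance `s`. -/
theorem tendsto_average_filter_mul {v : PowerSeries ℝ} {s : ℝ}
    (hv : ∀ h : ℕ, Tendsto (fun n : ℕ => (n : ℝ)⁻¹ * ∑ k ∈ Finset.range n,
      PowerSeries.coeff k v * PowerSeries.coeff (k + h) v) atTop (𝓝 (if h = 0 then s else 0)))
    {f g : PowerSeries ℝ} (hf : Summable fun n => ‖PowerSeries.coeff n f‖)
    (hg : Summable fun n => ‖PowerSeries.coeff n g‖) :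
    Tendsto (fun n : ℕ => (n : ℝ)⁻¹ * ∑ k ∈ Finset.range n,
      PowerSeries.coeff k (f * v) * PowerSeries.coeff k (g * v)) atTop
      (𝓝 (s * ∑' i, PowerSeries.coeff i f * PowerSeries.coeff i g)) := by
  set w : ℕ → ℝ := fun k => PowerSeries.coeff k v with hw
  set a : ℕ → ℝ := fun k => PowerSeries.coeff k f with ha
  set b : ℕ → ℝ := fun k => PowerSeries.coeff k g with hb
  let A : ℕ → ℕ × ℕ → ℝ := fun n ij => (n : ℝ)⁻¹ * ∑ k ∈ Finset.range n,
      (if ij.1 ≤ k then w (k - ij.1) else 0) * (if ij.2 ≤ k then w (k - ij.2) else 0)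
  obtain ⟨C, hC⟩ : ∃ C : ℝ, ∀ n : ℕ, (n : ℝ)⁻¹ * ∑ k ∈ Finset.range n, w k ^ 2 ≤ C := by
    have h0 := hv 0
    simp only [add_zero, if_true, ← sq] at h0
    obtain ⟨C, hC⟩ := h0.bddAbove_range
    exact ⟨C, fun n => hC ⟨n, rfl⟩⟩
  have h1 : ∀ n : ℕ, (n : ℝ)⁻¹ * ∑ k ∈ Finset.range n,
      PowerSeries.coeff k (f * v) * PowerSeries.coeff k (g * v)
      = ∑' ij : ℕ × ℕ, a ij.1 * b ij.2 * A n ij := by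
    intro n
    -- For fixed `n` the double series is finite: a lag of at least `n` only sees the zero padding.
    rw [tsum_eq_sum (s := Finset.range n ×ˢ Finset.range n)]
    · have : ∀ k ∈ Finset.range n, PowerSeries.coeff k (f * v) * PowerSeries.coeff k (g * v)
          = ∑ ij ∈ Finset.range n ×ˢ Finset.range n, a ij.1 * b ij.2 *
          ((if ij.1 ≤ k then w (k - ij.1) else 0) * (if ij.2 ≤ k then w (k - ij.2) else 0)) := by
        intro k hk
        rw [Finset.mem_range] at hk
        rw [coeff_mul_eq_sum_lag f v hk, coeff_mul_eq_sum_lag g v hk, Finset.sum_mul_sum,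
          Finset.sum_product]
        refine Finset.sum_congr rfl fun i _ => Finset.sum_congr rfl fun j _ => ?_
        simp only [ha, hb, hw]; ring
      rw [Finset.sum_congr rfl this, Finset.sum_comm, Finset.mul_sum]
      refine Finset.sum_congr rfl fun ij _ => ?_
      simp only [A]
      rw [← Finset.mul_sum]; ring
    · rintro ⟨i, j⟩ hij
      simp only [Finset.mem_product, Finset.mem_range, not_and_or] at hij
      have : A n (i, j) = 0 := by
        simp only [A]
        rw [Finset.sum_eq_zero, mul_zero]
        intro k hk
        rw [Finset.mem_range] at hk
        rcases hij with h | h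
        · rw [if_neg (by omega), zero_mul]
        · rw [if_neg (by omega : ¬ j ≤ k), mul_zero]
      rw [this, mul_zero]
  simp only [h1]
  have h2 : s * ∑' i, a i * b i
      = ∑' ij : ℕ × ℕ, a ij.1 * b ij.2 * (if ij.1 = ij.2 then s else 0) := by
    have hinj : Function.Injective fun i : ℕ => (i, i) := fun i j h => (Prod.ext_iff.1 h).1
    rw [← hinj.tsum_eq, ← tsum_mul_left]
    · exact tsum_congr fun i => by simp [mul_comm]
    · rintro ⟨i, j⟩ h
      by_cases hij : i = j
      · exact ⟨i, by rw [hij]⟩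
      · simp [hij] at h
  rw [h2]
  refine tendsto_tsum_of_dominated_convergence (bound := fun ij => ‖a ij.1‖ * ‖b ij.2‖ * C)
    ?_ ?_ ?_
  · exact (hf.mul_of_nonneg hg (fun _ => norm_nonneg _) (fun _ => norm_nonneg _)).mul_right C
  · rintro ⟨i, j⟩
    exact (tendsto_average_lag_mul hv i j).const_mul _
  · refine Eventually.of_forall fun n ij => ?_
    rw [norm_mul, norm_mul]
    exact mul_le_mul_of_nonneg_left (abs_average_lag_mul_le hC _ _ _) (by positivity)

/-- The coefficients of `(1 - θ₁ z - ⋯ - θ_p z^p)⁻¹` are absolutely summable if `‖θ‖₁ < 1`. -/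
theorem summable_norm_coeff_of_mul_eq_one {p : ℕ} {θ : Fin p → ℝ} (hθ : ∑ i, |θ i| < 1)
    {A : PowerSeries ℝ}
    (hA : (1 - ∑ i, PowerSeries.C (θ i) * PowerSeries.X ^ ((i : ℕ) + 1)) * A = 1) :
    Summable fun n => ‖PowerSeries.coeff n A‖ := by
  have hA' : A = 1 + ∑ i, PowerSeries.C (θ i) * (PowerSeries.X ^ ((i : ℕ) + 1) * A) := by
    rw [sub_mul, one_mul, Finset.sum_mul, sub_eq_iff_eq_add] at hA
    simpa only [mul_assoc] using hA
  -- The partial sums `L` of `|A_k|` satisfy `L ≤ 1 + ‖θ‖₁ L`, read off from the fixed point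
  -- equation `hA'`.
  refine summable_of_sum_range_le (c := (1 - ∑ i, |θ i|)⁻¹) (fun _ => norm_nonneg _) fun n => ?_
  have h1 : ∀ i : Fin p, ∑ k ∈ Finset.range n,
      ‖PowerSeries.coeff k (PowerSeries.X ^ ((i : ℕ) + 1) * A)‖
      ≤ ∑ k ∈ Finset.range n, ‖PowerSeries.coeff k A‖ := by
    intro i
    -- Square roots turn the `ℓ¹` comparison into `sum_range_lag_sq_le`.
    have e : ∀ k, ‖PowerSeries.coeff k (PowerSeries.X ^ ((i : ℕ) + 1) * A)‖
        = (if (i : ℕ) + 1 ≤ k then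
            (fun m => √‖PowerSeries.coeff m A‖) (k - ((i : ℕ) + 1)) else 0) ^ 2 := by
      intro k
      rw [PowerSeries.coeff_X_pow_mul']
      split_ifs
      · rw [Real.sq_sqrt (norm_nonneg _)]
      · simp
    have := sum_range_lag_sq_le (fun m => √‖PowerSeries.coeff m A‖) ((i : ℕ) + 1) n
    simpa only [e, Real.sq_sqrt (norm_nonneg _)] using this
  have h2 : ∑ k ∈ Finset.range n, ‖PowerSeries.coeff k A‖
      ≤ 1 + (∑ i, |θ i|) * ∑ k ∈ Finset.range n, ‖PowerSeries.coeff k A‖ := by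
    calc ∑ k ∈ Finset.range n, ‖PowerSeries.coeff k A‖
        ≤ ∑ k ∈ Finset.range n, ((if k = 0 then 1 else 0) +
          ∑ i, |θ i| * ‖PowerSeries.coeff k (PowerSeries.X ^ ((i : ℕ) + 1) * A)‖) := by
          refine Finset.sum_le_sum fun k _ => ?_
          conv_lhs => rw [hA']
          rw [map_add, map_sum, PowerSeries.coeff_one]
          refine (norm_add_le _ _).trans (add_le_add ?_ ((norm_sum_le _ _).trans ?_))
          · split_ifs <;> simp
          · refine Finset.sum_le_sum fun i _ => ?_
            rw [PowerSeries.coeff_C_mul, norm_mul, Real.norm_eq_abs]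
      _ ≤ _ := by
          rw [Finset.sum_add_distrib, Finset.sum_comm, Finset.sum_mul]
          refine add_le_add ?_ (Finset.sum_le_sum fun i _ => ?_)
          · rw [Finset.sum_ite_eq']; split_ifs <;> simp
          · rw [← Finset.mul_sum]
            exact mul_le_mul_of_nonneg_left (h1 i) (abs_nonneg _)
  rw [← one_div, le_div_iff₀ (by linarith)]
  linarith

theorem summable_norm_coeff_mul {f g : PowerSeries ℝ}
    (hf : Summable fun n => ‖PowerSeries.coeff n f‖)
    (hg : Summable fun n => ‖PowerSeries.coeff n g‖) :
    Summable fun n => ‖PowerSeries.coeff n (f * g)‖ := by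
  simpa only [PowerSeries.coeff_mul] using summable_norm_sum_mul_antidiagonal_of_summable_norm hf hg

theorem summable_norm_coeff_X_pow_mul {f : PowerSeries ℝ}
    (hf : Summable fun n => ‖PowerSeries.coeff n f‖) (i : ℕ) :
    Summable fun n => ‖PowerSeries.coeff n (PowerSeries.X ^ i * f)‖ := by
  refine summable_norm_coeff_mul ?_ hf
  refine summable_of_ne_finset_zero (s := {i}) fun n hn => ?_
  rw [PowerSeries.coeff_X_pow, if_neg (by simpa using hn), norm_zero]

/-! ### Forward and backward prediction in a stationary sequence -/

section Levinson

variable {E : Type*} [NormedAddCommGroup E] [InnerProductSpace ℝ E]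

/-- The forward prediction residual. -/
def forwardResidual {p : ℕ} (T : ℕ → E) (t : Fin p → ℝ) : E :=
  T 0 - ∑ i, t i • T ((i : ℕ) + 1)

/-- The backward prediction residual. -/
def backwardResidual {p : ℕ} (T : ℕ → E) (t : Fin p → ℝ) : E :=
  T (p + 1) - ∑ i : Fin p, t i.rev • T ((i : ℕ) + 1)

theorem inner_add_add {T : ℕ → E}
    (hshift : ∀ i j, inner ℝ (T (i + 1)) (T (j + 1)) = inner ℝ (T i) (T j)) (m i j : ℕ) : inner ℝ (T (i + m)) (T (j + m)) = inner ℝ (T i) (T j) := by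
  induction m with
  | zero => rfl
  | succ m ih => rw [← ih, ← hshift (i + m)]; rfl

/-- The Gram matrix is symmetric Toeplitz, hence invariant under time reversal. -/
theorem inner_reverse {T : ℕ → E}
    (hshift : ∀ i j, inner ℝ (T (i + 1)) (T (j + 1)) = inner ℝ (T i) (T j)) {n i j : ℕ} (hi : i ≤ n) (hj : j ≤ n) :
    inner ℝ (T (n - i)) (T (n - j)) = inner ℝ (T i) (T j) := by
  wlog hij : i ≤ j generalizing i j
  · rw [real_inner_comm, this hj hi (by omega), real_inner_comm]
  obtain ⟨h, rfl⟩ := Nat.exists_eq_add_of_le hij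
  have h1 := inner_add_add hshift (n - (i + h)) h 0
  have h2 := inner_add_add hshift i 0 h
  rw [show h + (n - (i + h)) = n - i by omega, zero_add] at h1
  rw [zero_add, add_comm h i] at h2
  rw [h1, h2, real_inner_comm]

theorem inner_backwardResidual {T : ℕ → E}
    (hshift : ∀ i j, inner ℝ (T (i + 1)) (T (j + 1)) = inner ℝ (T i) (T j)) {p : ℕ} (t : Fin p → ℝ) {m : ℕ} (hm : m ≤ p + 1) :
    inner ℝ (backwardResidual T t) (T (p + 1 - m)) = inner ℝ (forwardResidual T t) (T m) := by
  rw [backwardResidual, forwardResidual, inner_sub_left, inner_sub_left, sum_inner, sum_inner]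
  have h0 := inner_reverse hshift (Nat.zero_le (p + 1)) hm
  rw [Nat.sub_zero] at h0
  rw [h0, ← Equiv.sum_comp Fin.revPerm]
  congr 1
  refine Finset.sum_congr rfl fun i _ => ?_
  rw [real_inner_smul_left, real_inner_smul_left,
    ← inner_reverse hshift (by omega : (i : ℕ) + 1 ≤ p + 1) hm]
  simp only [Fin.revPerm_apply, Fin.rev_rev, Fin.val_rev]
  rw [show p - ((i : ℕ) + 1) + 1 = p + 1 - (i + 1) by omega]

/-- A stationary sequence `T`, with `T i` in the role of the value `i` steps in the past, whose
innovation `e` splits into forward and backward residuals with partial autocorrelation `-c`. -/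
structure LevinsonDecomposition {p : ℕ} (T : ℕ → E) (e : E) (t : Fin p → ℝ) (c : ℝ) : Prop where
  shift : ∀ i j, inner ℝ (T (i + 1)) (T (j + 1)) = inner ℝ (T i) (T j)
  orth : ∀ h, inner ℝ e (T (h + 1)) = 0
  abs_lt_one : |c| < 1
  eq_add : e = forwardResidual T t + c • backwardResidual T t

namespace LevinsonDecomposition

variable {p : ℕ} {T : ℕ → E} {e : E} {t : Fin p → ℝ} {c : ℝ}

/-- These are the Yule–Walker equations for `t`. Pairing `e = F + c B` with `T m` and with `T (p + 1
- m)` gives a 2 × 2 homogeneous system of determinant `1 - c²`. -/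
theorem inner_forwardResidual_eq_zero (H : LevinsonDecomposition T e t c) {m : ℕ} (hm1 : 1 ≤ m) (hmp : m ≤ p) :
    inner ℝ (forwardResidual T t) (T m) = 0 := by
  have key : ∀ m, 1 ≤ m → m ≤ p → inner ℝ (forwardResidual T t) (T m)
      + c * inner ℝ (forwardResidual T t) (T (p + 1 - m)) = 0 := by
    intro m h1 h2
    have := H.orth (m - 1)
    rw [Nat.sub_add_cancel h1, H.eq_add, inner_add_left, real_inner_smul_left] at this
    have h3 := inner_backwardResidual H.shift t (by omega : p + 1 - m ≤ p + 1)
    rw [show p + 1 - (p + 1 - m) = m by omega] at h3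
    rwa [h3] at this
  have h1 := key m hm1 hmp
  have h2 := key (p + 1 - m) (by omega) (by omega)
  rw [show p + 1 - (p + 1 - m) = m by omega] at h2
  have h3 : (1 - c ^ 2) * inner ℝ (forwardResidual T t) (T m) = 0 := by
    linear_combination h1 - c * h2
  have : 1 - c ^ 2 ≠ 0 := by
    have := (sq_lt_one_iff_abs_lt_one c).2 H.abs_lt_one
    linarith
  exact (mul_eq_zero.1 h3).resolve_left this

theorem norm_sq_forwardResidual (H : LevinsonDecomposition T e t c) :
    ‖forwardResidual T t‖ ^ 2 = inner ℝ (forwardResidual T t) (T 0) := by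
  rw [← real_inner_self_eq_norm_sq]
  nth_rw 2 [forwardResidual]
  rw [inner_sub_right, inner_sum, Finset.sum_eq_zero, sub_zero]
  intro i _
  rw [real_inner_smul_right, inner_forwardResidual_eq_zero H (by omega) (by omega),
    mul_zero]

theorem inner_forwardResidual_last (H : LevinsonDecomposition T e t c) :
    inner ℝ (forwardResidual T t) (T (p + 1)) = -c * ‖forwardResidual T t‖ ^ 2 := by
  have h1 := H.orth p
  have h2 := inner_backwardResidual H.shift t (Nat.zero_le (p + 1))
  rw [Nat.sub_zero] at h2
  rw [H.eq_add, inner_add_left, real_inner_smul_left, h2,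
    ← norm_sq_forwardResidual H] at h1
  linarith

/-- Orthogonality of `e` to the past gives `‖e‖² = ⟨e, T 0⟩`; there `F` contributes `‖F‖²` and `c B`
contributes `c ⟨F, T (p + 1)⟩ = -c² ‖F‖²`. -/
theorem norm_sq_innovation (H : LevinsonDecomposition T e t c) : ‖e‖ ^ 2 = (1 - c ^ 2) * ‖forwardResidual T t‖ ^ 2 := by
  have he := H.orth
  have h1 : inner ℝ e (forwardResidual T t) = inner ℝ e (T 0) := by
    rw [forwardResidual, inner_sub_right, inner_sum, Finset.sum_eq_zero, sub_zero]
    intro i _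
    rw [real_inner_smul_right, H.orth, mul_zero]
  have h2 : inner ℝ e (backwardResidual T t) = 0 := by
    rw [backwardResidual, inner_sub_right, inner_sum, Finset.sum_eq_zero, H.orth, sub_zero]
    intro i _
    rw [real_inner_smul_right, H.orth, mul_zero]
  have h3 : ‖e‖ ^ 2 = inner ℝ e (T 0) := by
    rw [← real_inner_self_eq_norm_sq]
    nth_rw 2 [H.eq_add]
    rw [inner_add_right, real_inner_smul_right, h1, h2, mul_zero, add_zero]
  have h4 := inner_backwardResidual H.shift t (le_refl (p + 1))
  rw [Nat.sub_self] at h4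
  rw [h3, H.eq_add, inner_add_left, real_inner_smul_left, h4,
    inner_forwardResidual_last H, ← norm_sq_forwardResidual H]
  ring

/-- The lag-one covariance of the limiting residuals, needed for `ρ̂_n`. Of the shifted residual
only the `T (p + 1)` term is not orthogonal to `F` a priori. -/
theorem inner_forwardResidual_shift (H : LevinsonDecomposition T e t c) (hp : 0 < p) :
    inner ℝ (forwardResidual T t) (forwardResidual (fun i => T (i + 1)) t)
      = c * t ⟨p - 1, Nat.sub_lt hp one_pos⟩ * ‖forwardResidual T t‖ ^ 2 := by
  rw [forwardResidual.eq_def (fun i => T (i + 1)), inner_sub_right, inner_sum,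
    inner_forwardResidual_eq_zero H le_rfl hp,
    Finset.sum_eq_single ⟨p - 1, Nat.sub_lt hp one_pos⟩]
  · rw [real_inner_smul_right]
    simp only
    rw [show p - 1 + 1 + 1 = p + 1 by omega, inner_forwardResidual_last H]
    ring
  · intro i _ hi
    have : (i : ℕ) ≠ p - 1 := fun h => hi (Fin.ext h)
    rw [real_inner_smul_right,
      inner_forwardResidual_eq_zero H (by omega) (by omega), mul_zero]
  · simp

end LevinsonDecomposition

end Levinson

/-! ### Autoregressive polynomials and index bookkeeping -/

/-- With `c = θ_p ρ`, `α (I - c J)` is the inverse of `I + c J`, because `J² = I` and `α = 1 / (1 -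
c²)`. -/
theorem beta_eq {p : ℕ} (hp : 1 ≤ p) (θ : Fin p → ℝ) {ρ : ℝ} (hc : |θ (lastIndex hp) * ρ| < 1)
    (i : Fin p) : beta θ ρ i
      = thetaStar hp θ ρ i + θ (lastIndex hp) * ρ * thetaStar hp θ ρ i.rev := by
  have hJ : ∀ w : Fin p → ℝ, ∀ i, (exchangeMatrix p *ᵥ w) i = w i.rev := by
    intro w i
    simp [exchangeMatrix, Matrix.mulVec, dotProduct]
  have ht : ∀ i, thetaStar hp θ ρ i
      = alpha hp θ ρ * (beta θ ρ i - θ (lastIndex hp) * ρ * beta θ ρ i.rev) := by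
    intro i
    rw [thetaStar, Matrix.sub_mulVec, Matrix.one_mulVec, Matrix.smul_mulVec]
    simp only [Pi.smul_apply, Pi.sub_apply, smul_eq_mul, hJ]
  rw [ht, ht, Fin.rev_rev, alpha]
  obtain ⟨h1, h2⟩ := abs_lt.1 hc
  have h3 : 1 - θ (lastIndex hp) * ρ ≠ 0 := by linarith
  have h4 : 1 + θ (lastIndex hp) * ρ ≠ 0 := by linarith
  field_simp
  ring

/-- The product of the autoregressive polynomials of orders `p` and `1`. -/
theorem arPolynomial_mul {p : ℕ} (hp : 1 ≤ p) (θ : Fin p → ℝ) (ρ : ℝ) :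
    (1 - ∑ i, PowerSeries.C (θ i) * PowerSeries.X ^ ((i : ℕ) + 1))
        * (1 - PowerSeries.C ρ * PowerSeries.X)
      = 1 - ∑ i, PowerSeries.C (beta θ ρ i) * PowerSeries.X ^ ((i : ℕ) + 1)
        + PowerSeries.C (θ (lastIndex hp) * ρ) * PowerSeries.X ^ (p + 1) := by
  obtain ⟨q, rfl⟩ : ∃ q, p = q + 1 := ⟨p - 1, by omega⟩
  have hlast : lastIndex hp = Fin.last q := rfl
  -- The cross terms `θ_i ρ` with `i < p` go into `β`; the last one is left over as the coefficient
  -- of `z^(p+1)`.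
  have h1 : ∑ i, PowerSeries.C (beta θ ρ i) * (PowerSeries.X : PowerSeries ℝ) ^ ((i : ℕ) + 1)
      = ∑ i, PowerSeries.C (θ i) * PowerSeries.X ^ ((i : ℕ) + 1)
        + PowerSeries.C ρ * PowerSeries.X
        - ∑ i : Fin q, PowerSeries.C (θ i.castSucc) * PowerSeries.X ^ ((i : ℕ) + 1)
          * (PowerSeries.C ρ * PowerSeries.X) := by
    rw [Fin.sum_univ_succ, Fin.sum_univ_succ (n := q)]
    have : ∀ i : Fin q, beta θ ρ i.succ = θ i.succ - θ i.castSucc * ρ := by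
      intro i
      simp only [beta, Fin.val_succ, Nat.add_eq_zero_iff, one_ne_zero, and_false, if_false]
      rfl
    simp only [this, map_sub, map_mul, sub_mul, Finset.sum_sub_distrib]
    have h0 : beta θ ρ (0 : Fin (q + 1)) = θ 0 + ρ := by simp [beta]
    have h2 : ∑ i : Fin q, PowerSeries.C (θ i.castSucc) * PowerSeries.C ρ
          * (PowerSeries.X : PowerSeries ℝ) ^ ((i.succ : ℕ) + 1)
        = ∑ i : Fin q, PowerSeries.C (θ i.castSucc) * PowerSeries.X ^ ((i : ℕ) + 1)
          * (PowerSeries.C ρ * PowerSeries.X) := by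
      refine Finset.sum_congr rfl fun i _ => ?_
      rw [Fin.val_succ]; ring
    rw [h0, h2, map_add]
    simp only [Fin.val_zero, zero_add, pow_one]
    ring
  rw [h1, hlast, Fin.sum_univ_castSucc, ← Finset.sum_mul]
  simp only [Fin.val_castSucc, Fin.val_last, map_mul]
  ring

/-- The zero padding of power series matches the initial values `x (-1) = ⋯ = x (-p) = 0`, and
nothing is known before time `-p`. -/
theorem coeff_X_pow_mul_path {p : ℕ} {x : ℤ → ℝ} (hx : ∀ j : ℕ, 1 ≤ j → j ≤ p → x (-(j : ℤ)) = 0)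
    {i k : ℕ} (hi : i ≤ k + p) :
    PowerSeries.coeff k (PowerSeries.X ^ i * PowerSeries.mk fun n : ℕ => x n)
      = x ((k : ℤ) - (i : ℤ)) := by
  rw [PowerSeries.coeff_X_pow_mul']
  split_ifs with h
  · rw [PowerSeries.coeff_mk, Nat.cast_sub h]
  · have := hx (i - k) (by omega) (by omega)
    rw [Nat.cast_sub (by omega)] at this
    rw [← this]; congr 1; ring

theorem tendsto_inv_mul_of_succ {u : ℕ → ℝ} {L : ℝ}
    (h : Tendsto (fun n : ℕ => ((n + 1 : ℕ) : ℝ)⁻¹ * u n) atTop (𝓝 L)) :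
    Tendsto (fun n : ℕ => (n : ℝ)⁻¹ * u n) atTop (𝓝 L) := by
  have h2 : Tendsto (fun n : ℕ => 1 + (n : ℝ)⁻¹) atTop (𝓝 (1 + 0)) :=
    tendsto_const_nhds.add tendsto_inv_atTop_nhds_zero_nat
  have h3 := h2.mul h
  rw [add_zero, one_mul] at h3
  refine h3.congr' ?_
  filter_upwards [eventually_gt_atTop 0] with n hn
  have : (n : ℝ) ≠ 0 := by positivity
  have h' : (n : ℝ) + 1 ≠ 0 := by positivity
  push_cast
  field_simp

theorem tendsto_average_succ {y : ℕ → ℝ} {L : ℝ}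
    (h : Tendsto (fun n : ℕ => (n : ℝ)⁻¹ * ∑ k ∈ Finset.range n, y k) atTop (𝓝 L)) :
    Tendsto (fun n : ℕ => (n : ℝ)⁻¹ * ∑ k ∈ Finset.range (n + 1), y k) atTop (𝓝 L) :=
  tendsto_inv_mul_of_succ ((tendsto_add_atTop_iff_nat 1).2 h)

/-! ### Limits of the estimators along a fixed path -/

section Estimators

variable {E : Type*} [NormedAddCommGroup E] [InnerProductSpace ℝ E]

/-- The lagged paths of `x` have sample second moments converging to `s` times the Gram matrix of
`T`. -/
structure HasLimitCovariance (p : ℕ) (x : ℤ → ℝ) (T : ℕ → E) (s : ℝ) : Prop where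
  init_neg : ∀ j : ℕ, 1 ≤ j → j ≤ p → x (-(j : ℤ)) = 0
  tendsto : ∀ i j : ℕ, Tendsto (fun n : ℕ => (n : ℝ)⁻¹ * ∑ k ∈ Finset.range n,
    PowerSeries.coeff k (PowerSeries.X ^ i * PowerSeries.mk fun n : ℕ => x n)
      * PowerSeries.coeff k (PowerSeries.X ^ j * PowerSeries.mk fun n : ℕ => x n)) atTop
    (𝓝 (s * inner ℝ (T i) (T j)))

namespace HasLimitCovariance

variable {p : ℕ} {x : ℤ → ℝ} {T : ℕ → E} {s : ℝ}

theorem tendsto_designMatrix (H : HasLimitCovariance p x T s) (S : Matrix (Fin p) (Fin p) ℝ) :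
    Tendsto (fun n : ℕ => (n : ℝ)⁻¹ • designMatrix S x (n - 1)) atTop
      (𝓝 (s • Matrix.gram ℝ fun i : Fin p => T i)) := by
  refine tendsto_pi_nhds.2 fun i => tendsto_pi_nhds.2 fun j => ?_
  have h1 := (H.tendsto i j).add (tendsto_inv_atTop_nhds_zero_nat.mul_const (S i j))
  rw [zero_mul, add_zero] at h1
  refine h1.congr' ?_
  filter_upwards [eventually_ge_atTop 1] with n hn
  rw [designMatrix, Nat.sub_add_cancel hn]
  simp only [Matrix.smul_apply, Matrix.add_apply, Matrix.sum_apply, Matrix.vecMulVec_apply,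
    lagVector, smul_eq_mul, mul_add]
  congr 2
  refine Finset.sum_congr rfl fun k _ => ?_
  rw [coeff_X_pow_mul_path H.init_neg (by omega), coeff_X_pow_mul_path H.init_neg (by omega)]

theorem tendsto_sum_lagVector (H : HasLimitCovariance p x T s) :
    Tendsto (fun n : ℕ => (n : ℝ)⁻¹ • ∑ k ∈ Finset.Icc 1 n,
      x (k : ℤ) • lagVector p x ((k : ℤ) - 1)) atTop
      (𝓝 (fun i : Fin p => s * inner ℝ (T 0) (T ((i : ℕ) + 1)))) := by
  refine tendsto_pi_nhds.2 fun i => ?_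
  refine (tendsto_average_succ (H.tendsto 0 (i + 1))).congr fun n => ?_
  rw [Pi.smul_apply, Finset.sum_apply, smul_eq_mul, Finset.range_eq_Ico,
    Finset.sum_eq_sum_Ico_succ_bot (by omega)]
  have h0 : PowerSeries.coeff 0 (PowerSeries.X ^ ((i : ℕ) + 1)
      * PowerSeries.mk fun n : ℕ => x n) = 0 := by
    rw [PowerSeries.coeff_X_pow_mul', if_neg (by omega)]
  rw [h0, mul_zero, zero_add]
  congr 1
  refine Finset.sum_congr (by ext; simp) fun k hk => ?_
  rw [coeff_X_pow_mul_path H.init_neg (by omega), coeff_X_pow_mul_path H.init_neg (by omega)]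
  simp only [Pi.smul_apply, smul_eq_mul, lagVector]
  push_cast
  congr 2; ring

/-- For singular `D` both inverses are `0` by convention, so the normalisation by `1/n` is harmless
for every `n ≥ 1`. -/
theorem _root_.Matrix.inv_smul_inv_smul_mulVec {n : Type*} [Fintype n] [DecidableEq n]
    (D : Matrix n n ℝ) (b : n → ℝ) {a : ℝ} (ha : a ≠ 0) :
    (a⁻¹ • D)⁻¹ *ᵥ (a⁻¹ • b) = D⁻¹ *ᵥ b := by
  by_cases hD : IsUnit D.det
  · have h := Matrix.inv_smul' (A := D) (Units.mk0 a⁻¹ (inv_ne_zero ha)) hD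
    have h' : (a⁻¹ • D)⁻¹ = a • D⁻¹ := by
      simpa [Units.smul_def] using h
    rw [h', Matrix.smul_mulVec, Matrix.mulVec_smul, smul_smul, mul_inv_cancel₀ ha, one_smul]
  · have h' : ¬ IsUnit (a⁻¹ • D).det := by
      rw [Matrix.det_smul]
      simpa [ha] using hD
    rw [Matrix.nonsing_inv_apply_not_isUnit _ hD, Matrix.nonsing_inv_apply_not_isUnit _ h',
      Matrix.zero_mulVec, Matrix.zero_mulVec]

/-- The limiting normal equations are the Yule–Walker equations solved by `t`; their Gram matrix is
invertible, and inversion is continuous there. -/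
theorem tendsto_thetaHat (H : HasLimitCovariance p x T s) (hs : s ≠ 0)
    (hT : LinearIndependent ℝ fun i : Fin p => T i)
    (hshift : ∀ i j, inner ℝ (T (i + 1)) (T (j + 1)) = inner ℝ (T i) (T j))
    {t : Fin p → ℝ} (ht : ∀ m, 1 ≤ m → m ≤ p → inner ℝ (forwardResidual T t) (T m) = 0)
    (S : Matrix (Fin p) (Fin p) ℝ) :
    Tendsto (thetaHat S x) atTop (𝓝 t) := by
  set G : Matrix (Fin p) (Fin p) ℝ := s • Matrix.gram ℝ fun i : Fin p => T i with hG
  have hdet : G.det ≠ 0 := by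
    rw [hG, Matrix.det_smul]
    exact mul_ne_zero (pow_ne_zero _ hs)
      (Matrix.det_gram_ne_zero_iff_linearIndependent.2 hT)
  have hGt : G *ᵥ t = fun i : Fin p => s * inner ℝ (T 0) (T ((i : ℕ) + 1)) := by
    ext i
    have h := ht (i + 1) (by omega) (by omega)
    rw [forwardResidual, inner_sub_left, sum_inner, sub_eq_zero] at h
    rw [h, hG, Matrix.smul_mulVec, Pi.smul_apply, smul_eq_mul]
    congr 1
    simp only [Matrix.mulVec, dotProduct]
    refine Finset.sum_congr rfl fun j _ => ?_
    rw [real_inner_smul_left, hshift, Matrix.gram_apply, real_inner_comm, mul_comm]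
  have hlim : G⁻¹ *ᵥ (fun i : Fin p => s * inner ℝ (T 0) (T ((i : ℕ) + 1))) = t := by
    rw [← hGt, Matrix.mulVec_mulVec, Matrix.nonsing_inv_mul _ (isUnit_iff_ne_zero.2 hdet),
      Matrix.one_mulVec]
  have hinv : Tendsto (fun n : ℕ => ((n : ℝ)⁻¹ • designMatrix S x (n - 1))⁻¹) atTop (𝓝 G⁻¹) := by
    have hD := H.tendsto_designMatrix S
    have hdetlim := (continuous_id.matrix_det.tendsto G).comp hD
    have hadj := (continuous_id.matrix_adjugate.tendsto G).comp hD
    simp only [Matrix.inv_def, Ring.inverse_eq_inv']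
    exact (hdetlim.inv₀ hdet).smul hadj
  have hmul : Continuous fun q : Matrix (Fin p) (Fin p) ℝ × (Fin p → ℝ) => q.1 *ᵥ q.2 :=
    continuous_fst.matrix_mulVec continuous_snd
  have h := (hmul.tendsto _).comp (hinv.prodMk_nhds H.tendsto_sum_lagVector)
  simp only [hlim] at h
  refine h.congr' ?_
  filter_upwards [eventually_ge_atTop 1] with n hn
  exact Matrix.inv_smul_inv_smul_mulVec _ _ (by positivity)

theorem residual_eq (H : HasLimitCovariance p x T s) (S : Matrix (Fin p) (Fin p) ℝ) (n k : ℕ) :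
    residual S x n k = PowerSeries.coeff k (PowerSeries.X ^ 0 * PowerSeries.mk fun n : ℕ => x n)
      - ∑ i, thetaHat S x n i * PowerSeries.coeff k
        (PowerSeries.X ^ ((i : ℕ) + 1) * PowerSeries.mk fun n : ℕ => x n) := by
  rcases Nat.eq_zero_or_pos k with rfl | hk
  · rw [residual, if_pos rfl, Finset.sum_eq_zero]
    · simp
    · intro i _
      rw [PowerSeries.coeff_X_pow_mul', if_neg (by omega), mul_zero]
  · rw [residual, if_neg (by omega), coeff_X_pow_mul_path H.init_neg (by omega), dotProduct]
    simp only [Nat.cast_zero, sub_zero, lagVector]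
    congr 1
    refine Finset.sum_congr rfl fun i _ => ?_
    rw [coeff_X_pow_mul_path H.init_neg (by omega)]
    congr 2; push_cast; ring

/-- Rewrites the earlier factor of `ε̂_k ε̂_{k-1}` as a lagged filter read at the same time as the
later one. -/
theorem residual_pred_eq (H : HasLimitCovariance p x T s) (S : Matrix (Fin p) (Fin p) ℝ)
    (n k : ℕ) :
    residual S x n k
      = PowerSeries.coeff (k + 1) (PowerSeries.X ^ 1 * PowerSeries.mk fun n : ℕ => x n)
      - ∑ i, thetaHat S x n i * PowerSeries.coeff (k + 1)
        (PowerSeries.X ^ ((i : ℕ) + 1 + 1) * PowerSeries.mk fun n : ℕ => x n) := by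
  rw [H.residual_eq]
  have : ∀ i, PowerSeries.coeff (k + 1) (PowerSeries.X ^ (i + 1) * PowerSeries.mk fun n : ℕ => x n)
      = PowerSeries.coeff k (PowerSeries.X ^ i * PowerSeries.mk fun n : ℕ => x n) := by
    intro i
    rw [pow_succ', mul_assoc, PowerSeries.coeff_succ_X_mul]
  simp only [this]

/-- Sample second moments of the residuals built from a convergent sequence of regression
parameters. -/
theorem tendsto_average_residual (H : HasLimitCovariance p x T s) {a : ℕ → Fin p → ℝ}
    {t : Fin p → ℝ} (ha : Tendsto a atTop (𝓝 t)) (m : ℕ) :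
    Tendsto (fun n : ℕ => (n : ℝ)⁻¹ * ∑ k ∈ Finset.range n,
      (PowerSeries.coeff k (PowerSeries.X ^ 0 * PowerSeries.mk fun n : ℕ => x n)
      - ∑ i, a n i * PowerSeries.coeff k
        (PowerSeries.X ^ ((i : ℕ) + 1) * PowerSeries.mk fun n : ℕ => x n)) *
      (PowerSeries.coeff k (PowerSeries.X ^ m * PowerSeries.mk fun n : ℕ => x n)
      - ∑ i, a n i * PowerSeries.coeff k
        (PowerSeries.X ^ ((i : ℕ) + 1 + m) * PowerSeries.mk fun n : ℕ => x n))) atTop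
      (𝓝 (s * inner ℝ (forwardResidual T t) (forwardResidual (fun i => T (i + m)) t))) := by
  set Y : ℕ → ℕ → ℝ := fun i k =>
    PowerSeries.coeff k (PowerSeries.X ^ i * PowerSeries.mk fun n : ℕ => x n) with hY
  have hai : ∀ i, Tendsto (fun n => a n i) atTop (𝓝 (t i)) := tendsto_pi_nhds.1 ha
  set N : ℕ → ℕ → ℕ → ℝ := fun i j n => (n : ℝ)⁻¹ * ∑ k ∈ Finset.range n, Y i k * Y j k with hN
  -- The coefficients `a n i` do not depend on `k`, so they leave the average and the bilinear
  -- expansion converges termwise.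
  have hlim : Tendsto (fun n => N 0 m n - ∑ i : Fin p, a n i * N (i + 1) m n
      - (∑ j : Fin p, a n j * N 0 (j + 1 + m) n
        - ∑ i : Fin p, ∑ j : Fin p, a n i * a n j * N (i + 1) (j + 1 + m) n)) atTop
      (𝓝 (s * inner ℝ (T 0) (T m) - ∑ i : Fin p, t i * (s * inner ℝ (T (i + 1)) (T m))
        - (∑ j : Fin p, t j * (s * inner ℝ (T 0) (T (j + 1 + m)))
          - ∑ i : Fin p, ∑ j : Fin p,
            t i * t j * (s * inner ℝ (T (i + 1)) (T (j + 1 + m)))))) :=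
    ((H.tendsto _ _).sub (tendsto_finsetSum _ fun i _ => (hai i).mul (H.tendsto _ _))).sub
      ((tendsto_finsetSum _ fun j _ => (hai j).mul (H.tendsto _ _)).sub
      (tendsto_finsetSum _ fun i _ => tendsto_finsetSum _ fun j _ =>
        ((hai i).mul (hai j)).mul (H.tendsto _ _)))
  convert hlim using 1
  · ext n
    change (n : ℝ)⁻¹ * ∑ k ∈ Finset.range n, (Y 0 k - ∑ i : Fin p, a n i * Y (i + 1) k)
      * (Y m k - ∑ i : Fin p, a n i * Y (i + 1 + m) k) = _
    simp only [sub_mul, mul_sub, Finset.sum_sub_distrib, Finset.sum_mul_sum, hN]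
    congr 1
    · congr 1
      simp only [Finset.mul_sum, Finset.sum_mul]
      rw [Finset.sum_comm]
      exact Finset.sum_congr rfl fun i _ => Finset.sum_congr rfl fun k _ => by ring
    · congr 1
      · simp only [Finset.mul_sum]
        rw [Finset.sum_comm]
        exact Finset.sum_congr rfl fun i _ => Finset.sum_congr rfl fun k _ => by ring
      · simp only [Finset.mul_sum]
        rw [Finset.sum_comm]
        refine Finset.sum_congr rfl fun i _ => ?_
        rw [Finset.sum_comm]
        exact Finset.sum_congr rfl fun i _ => Finset.sum_congr rfl fun k _ => by ring
  · congr 1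
    simp only [forwardResidual, inner_sub_left, inner_sub_right, inner_sum, sum_inner,
      real_inner_smul_left, real_inner_smul_right, mul_sub, Finset.mul_sum, zero_add,
      Finset.sum_sub_distrib]
    congr 1
    · congr 1
      exact Finset.sum_congr rfl fun i _ => by ring
    · congr 1
      · exact Finset.sum_congr rfl fun i _ => by ring
      · rw [Finset.sum_comm]
        exact Finset.sum_congr rfl fun i _ => Finset.sum_congr rfl fun k _ => by ring

/-- Consistency of the variance estimator, with eventually nonzero denominators. -/
theorem tendsto_sigmaSqHat (H : HasLimitCovariance p x T s) (hs : s ≠ 0)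
    (hT : LinearIndependent ℝ fun i : Fin p => T i) {e : E} (he : e ≠ 0) {t : Fin p → ℝ} {c : ℝ}
    (D : LevinsonDecomposition T e t c) (hp : 1 ≤ p) (ht : t (lastIndex hp) ≠ 0)
    (S : Matrix (Fin p) (Fin p) ℝ) :
    (∀ᶠ n : ℕ in atTop, ∑ k ∈ Finset.Icc 1 n, residual S x n (k - 1) ^ 2 ≠ 0 ∧
      thetaHat S x n (lastIndex hp) ≠ 0) ∧
    Tendsto (sigmaSqHat hp S x) atTop (𝓝 (s * ‖e‖ ^ 2)) := by
  have hθ := H.tendsto_thetaHat hs hT D.shift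
    (fun m h1 h2 => D.inner_forwardResidual_eq_zero h1 h2) S
  have hθp := tendsto_pi_nhds.1 hθ (lastIndex hp)
  have hnorm := D.norm_sq_innovation
  have hR : s * ‖forwardResidual T t‖ ^ 2 ≠ 0 := by
    refine mul_ne_zero hs fun h => he ?_
    rw [h, mul_zero] at hnorm
    simpa using hnorm
  -- Replacing `n` by `n + 1` then gives sums over `k = 0, …, n` of residuals still computed with
  -- `θ̂_n`.
  have hθ' : Tendsto (fun n => thetaHat S x (n - 1)) atTop (𝓝 t) :=
    hθ.comp (tendsto_sub_atTop_nat 1)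
  have hden : Tendsto (fun n : ℕ => (n : ℝ)⁻¹ *
      ∑ k ∈ Finset.Icc 1 n, residual S x n (k - 1) ^ 2) atTop
      (𝓝 (s * ‖forwardResidual T t‖ ^ 2)) := by
    have h := H.tendsto_average_residual hθ 0
    simp only [add_zero, ← H.residual_eq, ← sq] at h
    rw [real_inner_self_eq_norm_sq] at h
    refine h.congr fun n => ?_
    rw [← Finset.Ico_add_one_right_eq_Icc, Finset.sum_Ico_eq_sum_range]
    simp
  have hsq : Tendsto (fun n : ℕ => (n : ℝ)⁻¹ *
      ∑ k ∈ Finset.range (n + 1), residual S x n k ^ 2) atTop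
      (𝓝 (s * ‖forwardResidual T t‖ ^ 2)) := by
    have h := H.tendsto_average_residual hθ' 0
    simp only [add_zero, ← H.residual_eq, ← sq] at h
    rw [real_inner_self_eq_norm_sq] at h
    exact tendsto_inv_mul_of_succ ((tendsto_add_atTop_iff_nat 1).2 h)
  have hnum : Tendsto (fun n : ℕ => (n : ℝ)⁻¹ *
      ∑ k ∈ Finset.Icc 1 n, residual S x n k * residual S x n (k - 1)) atTop
      (𝓝 (c * t (lastIndex hp) * (s * ‖forwardResidual T t‖ ^ 2))) := by
    have h := tendsto_inv_mul_of_succ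
      ((tendsto_add_atTop_iff_nat 1).2 (H.tendsto_average_residual hθ' 1))
    rw [D.inner_forwardResidual_shift hp, mul_left_comm] at h
    refine h.congr fun n => ?_
    rw [← Finset.Ico_add_one_right_eq_Icc, Finset.sum_Ico_eq_sum_range, Finset.sum_range_succ',
      Nat.add_sub_cancel]
    have h0 : ∀ i, PowerSeries.coeff 0 (PowerSeries.X ^ (i + 1)
        * PowerSeries.mk fun n : ℕ => x n) = 0 := fun i => by
      rw [PowerSeries.coeff_X_pow_mul', if_neg (by omega)]
    simp only [← H.residual_pred_eq, ← H.residual_eq]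
    rw [h0 0]
    simp only [h0, mul_zero, Finset.sum_const_zero, sub_zero, add_zero]
    congr 1
    refine Finset.sum_congr rfl fun k _ => ?_
    rw [add_comm 1 k, Nat.add_sub_cancel]
  have hrho : Tendsto (rhoHat S x) atTop (𝓝 (c * t (lastIndex hp))) := by
    have h := (hden.inv₀ hR).mul hnum
    rw [mul_comm (c * _), inv_mul_cancel_left₀ hR] at h
    refine h.congr' ?_
    filter_upwards [eventually_gt_atTop 0] with n hn
    have : (n : ℝ) ≠ 0 := by positivity
    rw [rhoHat, mul_inv, inv_inv, mul_mul_mul_comm, mul_inv_cancel₀ this, one_mul]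
  refine ⟨?_, ?_⟩
  · filter_upwards [hden.eventually_ne hR, hθp.eventually_ne ht] with n h1 h2
    exact ⟨right_ne_zero_of_mul h1, h2⟩
  · have h := (((hrho.pow 2).mul ((hθp.pow 2).inv₀ (pow_ne_zero 2 ht))).const_sub 1).mul hsq
    -- Dividing by `t_p²` isolates `1 - c²`, the factor relating `‖e‖²` to `‖F‖²`.
    have hlim : (1 - (c * t (lastIndex hp)) ^ 2 * (t (lastIndex hp) ^ 2)⁻¹)
        * (s * ‖forwardResidual T t‖ ^ 2) = s * ‖e‖ ^ 2 := by
      rw [hnorm]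
      field_simp
    rw [hlim] at h
    refine h.congr fun n => ?_
    rw [sigmaSqHat, one_div]

end HasLimitCovariance

end Estimators

/-! ### The `ℓ²` model of the limiting covariances -/

/-- The coefficients of a power series as an element of `ℓ²`. -/
noncomputable def coeffL2 (f : PowerSeries ℝ) (hf : Summable fun n => ‖PowerSeries.coeff n f‖) :
    lp (fun _ : ℕ => ℝ) 2 :=
  ⟨fun n => PowerSeries.coeff n f, Memℓp.of_exponent_ge (q := 1)
    (memℓp_gen (by simpa using hf)) (by norm_num)⟩

theorem coeffL2_apply (f : PowerSeries ℝ) (hf : Summable fun n => ‖PowerSeries.coeff n f‖) (n : ℕ) :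
    coeffL2 f hf n = PowerSeries.coeff n f := rfl

theorem inner_coeffL2 (f g : PowerSeries ℝ) (hf : Summable fun n => ‖PowerSeries.coeff n f‖)
    (hg : Summable fun n => ‖PowerSeries.coeff n g‖) :
    inner ℝ (coeffL2 f hf) (coeffL2 g hg)
      = ∑' n, PowerSeries.coeff n f * PowerSeries.coeff n g := by
  rw [lp.inner_eq_tsum]
  exact tsum_congr fun n => by simp [coeffL2_apply, mul_comm]

theorem sum_smul_coeffL2_apply {ι : Type*} (s : Finset ι) (u : ι → ℝ) (f : ι → PowerSeries ℝ)
    (hf : ∀ i, Summable fun n => ‖PowerSeries.coeff n (f i)‖) (n : ℕ) :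
    (∑ i ∈ s, u i • coeffL2 (f i) (hf i) : lp (fun _ : ℕ => ℝ) 2) n
      = PowerSeries.coeff n (∑ i ∈ s, PowerSeries.C (u i) * f i) := by
  rw [lp.coeFn_sum, Finset.sum_apply, map_sum]
  refine Finset.sum_congr rfl fun i _ => ?_
  rw [lp.coeFn_smul, Pi.smul_apply, coeffL2_apply, PowerSeries.coeff_C_mul, smul_eq_mul]

section Lags

variable {ψ : PowerSeries ℝ} (hψ : Summable fun n => ‖PowerSeries.coeff n ψ‖)

/-- The lagged copies of a filter with absolutely summable coefficients, in `ℓ²`. -/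
noncomputable def lagL2 (i : ℕ) : lp (fun _ : ℕ => ℝ) 2 :=
  coeffL2 (PowerSeries.X ^ i * ψ) (summable_norm_coeff_X_pow_mul hψ i)

theorem inner_lagL2_succ (i j : ℕ) :
    inner ℝ (lagL2 hψ (i + 1)) (lagL2 hψ (j + 1)) = inner ℝ (lagL2 hψ i) (lagL2 hψ j) := by
  simp only [lagL2, inner_coeffL2]
  have h : Summable fun n => PowerSeries.coeff n (PowerSeries.X ^ (i + 1) * ψ)
      * PowerSeries.coeff n (PowerSeries.X ^ (j + 1) * ψ) := by
    have := lp.summable_inner (𝕜 := ℝ) (lagL2 hψ (j + 1)) (lagL2 hψ (i + 1))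
    simpa [lagL2, coeffL2_apply] using this
  rw [h.tsum_eq_zero_add, pow_succ' _ i, pow_succ' _ j]
  simp only [mul_assoc, PowerSeries.coeff_succ_X_mul, PowerSeries.coeff_zero_X_mul, mul_zero,
    zero_add]

/-- A linear relation is a polynomial annihilating `ψ`, and power series over `ℝ` form a domain. -/
theorem linearIndependent_lagL2 (h0 : ψ ≠ 0) (p : ℕ) :
    LinearIndependent ℝ fun i : Fin p => lagL2 hψ i := by
  rw [Fintype.linearIndependent_iff]
  intro u hu i
  have h1 : (∑ i : Fin p, PowerSeries.C (u i) * PowerSeries.X ^ (i : ℕ)) * ψ = 0 := by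
    ext n
    rw [Finset.sum_mul]
    simp only [mul_assoc]
    rw [← sum_smul_coeffL2_apply Finset.univ u (fun i : Fin p => PowerSeries.X ^ (i : ℕ) * ψ)
      (fun i => summable_norm_coeff_X_pow_mul hψ i)]
    exact congrArg (fun f : lp (fun _ : ℕ => ℝ) 2 => f n) hu
  have h2 := congrArg (PowerSeries.coeff (i : ℕ)) ((mul_eq_zero.1 h1).resolve_right h0)
  rw [map_sum, Finset.sum_eq_single i] at h2
  · simpa [PowerSeries.coeff_C_mul, PowerSeries.coeff_X_pow] using h2
  · intro j _ hj
    rw [PowerSeries.coeff_C_mul, PowerSeries.coeff_X_pow, if_neg, mul_zero]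
    exact fun h => hj (Fin.ext h.symm)
  · simp

/-- The innovation filter. -/
noncomputable def oneL2 : lp (fun _ : ℕ => ℝ) 2 := lp.single 2 0 1

theorem norm_oneL2 : ‖oneL2‖ = 1 := by
  rw [oneL2, lp.norm_single (by norm_num), norm_one]

theorem inner_oneL2_lagL2_succ (h : ℕ) : inner ℝ oneL2 (lagL2 hψ (h + 1)) = 0 := by
  rw [oneL2, lp.inner_single_left, lagL2, coeffL2_apply, PowerSeries.coeff_X_pow_mul',
    if_neg (by omega), inner_zero_right]

theorem levinsonDecomposition_lagL2 {p : ℕ} (hp : 1 ≤ p) {θ : Fin p → ℝ} {ρ : ℝ}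
    (hc : |θ (lastIndex hp) * ρ| < 1)
    (h1 : (1 - ∑ i, PowerSeries.C (θ i) * PowerSeries.X ^ ((i : ℕ) + 1))
        * (1 - PowerSeries.C ρ * PowerSeries.X) * ψ = 1) :
    LevinsonDecomposition (lagL2 hψ) oneL2 (thetaStar hp θ ρ) (θ (lastIndex hp) * ρ) where
  shift := inner_lagL2_succ hψ
  orth := inner_oneL2_lagL2_succ hψ
  abs_lt_one := hc
  eq_add := by
    have h2 : forwardResidual (lagL2 hψ) (thetaStar hp θ ρ)
        + (θ (lastIndex hp) * ρ) • backwardResidual (lagL2 hψ) (thetaStar hp θ ρ)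
        = lagL2 hψ 0 - ∑ i, beta θ ρ i • lagL2 hψ ((i : ℕ) + 1)
          + (θ (lastIndex hp) * ρ) • lagL2 hψ (p + 1) := by
      simp only [forwardResidual, backwardResidual, beta_eq hp θ hc, add_smul,
        Finset.sum_add_distrib, smul_sub, Finset.smul_sum, smul_smul]
      abel
    rw [h2]
    ext n
    rw [lp.coeFn_add, lp.coeFn_sub, lp.coeFn_smul, Pi.add_apply, Pi.sub_apply, Pi.smul_apply]
    simp only [lagL2]
    rw [sum_smul_coeffL2_apply Finset.univ (beta θ ρ)
      (fun i : Fin p => PowerSeries.X ^ ((i : ℕ) + 1) * ψ)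
      (fun i => summable_norm_coeff_X_pow_mul hψ _), coeffL2_apply, coeffL2_apply, smul_eq_mul,
      ← PowerSeries.coeff_C_mul, ← map_sub, ← map_add]
    have h3 : PowerSeries.X ^ 0 * ψ
        - ∑ i, PowerSeries.C (beta θ ρ i) * (PowerSeries.X ^ ((i : ℕ) + 1) * ψ)
        + PowerSeries.C (θ (lastIndex hp) * ρ) * (PowerSeries.X ^ (p + 1) * ψ) = 1 := by
      rw [← h1, arPolynomial_mul hp, add_mul, sub_mul, Finset.sum_mul]
      simp only [mul_assoc, pow_zero, one_mul]
    rw [h3, oneL2, PowerSeries.coeff_one]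
    rcases eq_or_ne n 0 with rfl | hn
    · simp
    · simp [hn]

end Lags

/-! ### From the recursion to consistency along a path -/

/-- The autoregressive recursion as an identity of generating functions. -/
theorem arPolynomial_mul_path {p : ℕ} {θ : Fin p → ℝ} {ρ : ℝ} {x : ℤ → ℝ} {e v : ℕ → ℝ}
    (hx : ∀ n : ℕ, 1 ≤ n → x n = ∑ i : Fin p, θ i * x ((n : ℤ) - ((i : ℕ) : ℤ) - 1) + e n)
    (he : ∀ n : ℕ, 1 ≤ n → e n = ρ * e (n - 1) + v n) (hx0 : x 0 = e 0) (hv0 : v 0 = x 0)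
    (hneg : ∀ j : ℕ, 1 ≤ j → j ≤ p → x (-(j : ℤ)) = 0) :
    (1 - ∑ i, PowerSeries.C (θ i) * PowerSeries.X ^ ((i : ℕ) + 1))
        * (1 - PowerSeries.C ρ * PowerSeries.X) * (PowerSeries.mk fun n : ℕ => x n)
      = PowerSeries.mk v := by
  have h1 : (1 - ∑ i, PowerSeries.C (θ i) * PowerSeries.X ^ ((i : ℕ) + 1))
      * (PowerSeries.mk fun n : ℕ => x n) = PowerSeries.mk e := by
    ext n
    rw [sub_mul, one_mul, Finset.sum_mul, map_sub, map_sum]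
    simp only [mul_assoc, PowerSeries.coeff_C_mul]
    rw [PowerSeries.coeff_mk, PowerSeries.coeff_mk]
    rcases Nat.eq_zero_or_pos n with rfl | hn
    · rw [Finset.sum_eq_zero, ← hx0]
      · simp
      · intro i _
        rw [PowerSeries.coeff_X_pow_mul', if_neg (by omega), mul_zero]
    · rw [hx n hn, sub_eq_iff_eq_add, add_comm]
      congr 1
      refine Finset.sum_congr rfl fun i _ => ?_
      rw [coeff_X_pow_mul_path hneg (by omega)]
      push_cast
      rw [sub_sub]
  rw [mul_right_comm, h1]
  ext n
  rw [mul_sub, mul_one, map_sub, mul_left_comm, PowerSeries.coeff_C_mul]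
  rcases n with _ | n
  · simp [hv0, hx0]
  · rw [PowerSeries.coeff_succ_mul_X]
    simp only [PowerSeries.coeff_mk]
    rw [he (n + 1) (by omega), Nat.add_sub_cancel]
    ring

/-- Consistency along a path whose innovations have the sample autocovariances of white noise. -/
theorem tendsto_sigmaSqHat_of_path {p : ℕ} (hp : 1 ≤ p) {θ : Fin p → ℝ} {ρ s : ℝ}
    (hθ1 : ∑ i, |θ i| < 1) (hρ : |ρ| < 1) (hs : s ≠ 0) {x : ℤ → ℝ} {e v : ℕ → ℝ}
    (hx : ∀ n : ℕ, 1 ≤ n → x n = ∑ i : Fin p, θ i * x ((n : ℤ) - ((i : ℕ) : ℤ) - 1) + e n)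
    (he : ∀ n : ℕ, 1 ≤ n → e n = ρ * e (n - 1) + v n) (hx0 : x 0 = e 0) (hv0 : v 0 = x 0)
    (hneg : ∀ j : ℕ, 1 ≤ j → j ≤ p → x (-(j : ℤ)) = 0)
    (hv : ∀ h : ℕ, Tendsto (fun n : ℕ => (n : ℝ)⁻¹ * ∑ k ∈ Finset.range n, v k * v (k + h)) atTop
      (𝓝 (if h = 0 then s else 0)))
    (hθstar : thetaStar hp θ ρ (lastIndex hp) ≠ 0) (S : Matrix (Fin p) (Fin p) ℝ) :
    (∀ᶠ n : ℕ in atTop, ∑ k ∈ Finset.Icc 1 n, residual S x n (k - 1) ^ 2 ≠ 0 ∧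
      thetaHat S x n (lastIndex hp) ≠ 0) ∧
    Tendsto (sigmaSqHat hp S x) atTop (𝓝 s) := by
  set Q : PowerSeries ℝ := 1 - ∑ i, PowerSeries.C (θ i) * PowerSeries.X ^ ((i : ℕ) + 1) with hQ
  set P : PowerSeries ℝ := 1 - PowerSeries.C ρ * PowerSeries.X with hP
  have hQ0 : PowerSeries.constantCoeff Q ≠ 0 := by simp [hQ]
  have hP0 : PowerSeries.constantCoeff P ≠ 0 := by simp [hP]
  have hQQ : Q * Q⁻¹ = 1 := PowerSeries.mul_inv_cancel Q hQ0
  have hPP : P * P⁻¹ = 1 := PowerSeries.mul_inv_cancel P hP0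
  have hψ1 : Q * P * (Q⁻¹ * P⁻¹) = 1 := by rw [mul_mul_mul_comm, hQQ, hPP, one_mul]
  have hψ : Summable fun n => ‖PowerSeries.coeff n (Q⁻¹ * P⁻¹)‖ := by
    refine summable_norm_coeff_mul (summable_norm_coeff_of_mul_eq_one hθ1 hQQ)
      -- `P` is the autoregressive polynomial of order one with coefficient `ρ`.
      (summable_norm_coeff_of_mul_eq_one (θ := fun _ : Fin 1 => ρ) (by simpa using hρ) ?_)
    simpa using hPP
  have hpath : (PowerSeries.mk fun n : ℕ => x n) = Q⁻¹ * P⁻¹ * PowerSeries.mk v := by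
    have h := arPolynomial_mul_path hx he hx0 hv0 hneg
    rw [← h, ← mul_assoc, mul_comm (Q⁻¹ * P⁻¹), hψ1, one_mul]
  have hc : |θ (lastIndex hp) * ρ| < 1 := by
    rw [abs_mul]
    have h1 : |θ (lastIndex hp)| ≤ ∑ i, |θ i| :=
      Finset.single_le_sum (f := fun i => |θ i|) (fun _ _ => abs_nonneg _) (Finset.mem_univ _)
    nlinarith [abs_nonneg ρ, abs_nonneg (θ (lastIndex hp))]
  have H : HasLimitCovariance p x (lagL2 hψ) s := by
    refine ⟨hneg, fun i j => ?_⟩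
    rw [hpath, lagL2, lagL2, inner_coeffL2]
    simp only [← mul_assoc (PowerSeries.X ^ _) (Q⁻¹ * P⁻¹) (PowerSeries.mk v)]
    exact tendsto_average_filter_mul (by simpa only [PowerSeries.coeff_mk] using hv)
      (summable_norm_coeff_X_pow_mul hψ i) (summable_norm_coeff_X_pow_mul hψ j)
  have hψ0 : Q⁻¹ * P⁻¹ ≠ 0 := right_ne_zero_of_mul_eq_one hψ1
  have hone : oneL2 ≠ 0 := norm_ne_zero_iff.1 (by rw [norm_oneL2]; exact one_ne_zero)
  have h := H.tendsto_sigmaSqHat hs (linearIndependent_lagL2 hψ hψ0 p) hone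
    (levinsonDecomposition_lagL2 hψ hp hc hψ1) hp hθstar S
  rwa [norm_oneL2, one_pow, mul_one] at h

/-! ### Strong law for lagged products -/

theorem sum_range_residue (w : ℕ → ℝ) {d r : ℕ} (hr : r < d) (n : ℕ) :
    ∑ k ∈ Finset.range n, (if k % d = r then w k else 0)
      = ∑ m ∈ Finset.range ((n + (d - 1 - r)) / d), w (r + m * d) := by
  induction n with
  | zero => rw [Nat.zero_add, Nat.div_eq_of_lt (by omega)]; rfl
  | succ n ih =>
    rw [Finset.sum_range_succ, ih, Nat.add_right_comm, Nat.succ_div]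
    by_cases h : n % d = r
    · obtain ⟨m, hm⟩ : ∃ m, n = r + m * d := ⟨n / d, by rw [← h, Nat.mod_add_div']⟩
      have h1 : n + (d - 1 - r) + 1 = d * (m + 1) := by
        rw [hm]; have : d - 1 - r + 1 + r = d := by omega
        linarith
      have h2 : (n + (d - 1 - r)) / d = m := by
        rw [hm, show r + m * d + (d - 1 - r) = d - 1 + m * d by omega,
          Nat.add_mul_div_right _ _ (by omega), Nat.div_eq_of_lt (by omega), zero_add]
      rw [if_pos h, if_pos ⟨_, h1⟩, h2, Finset.sum_range_succ, ← hm]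
    · rw [if_neg h, if_neg, add_zero, add_zero]
      rintro ⟨m, hm⟩
      obtain ⟨q, rfl⟩ : ∃ q, m = q + 1 := by
        rcases m with _ | q
        · omega
        · exact ⟨q, rfl⟩
      have hn : n = r + d * q := by
        rw [Nat.mul_succ] at hm; omega
      exact h (by rw [hn, Nat.add_mul_mod_self_left, Nat.mod_eq_of_lt hr])

/-- Averages that vanish along every residue class modulo `d` vanish. -/
theorem tendsto_average_of_residues {w : ℕ → ℝ} {d : ℕ} (hd : 0 < d)
    (h : ∀ r < d, Tendsto (fun n : ℕ => (n : ℝ)⁻¹ * ∑ m ∈ Finset.range n, w (r + m * d)) atTop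
      (𝓝 0)) :
    Tendsto (fun n : ℕ => (n : ℝ)⁻¹ * ∑ k ∈ Finset.range n, w k) atTop (𝓝 0) := by
  have h1 : ∀ n : ℕ, (n : ℝ)⁻¹ * ∑ k ∈ Finset.range n, w k = ∑ r ∈ Finset.range d,
      (n : ℝ)⁻¹ * ∑ m ∈ Finset.range ((n + (d - 1 - r)) / d), w (r + m * d) := by
    intro n
    rw [← Finset.mul_sum]
    congr 1
    rw [← Finset.sum_congr rfl fun r hr => sum_range_residue w (Finset.mem_range.1 hr) n,
      Finset.sum_comm]
    refine Finset.sum_congr rfl fun k _ => ?_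
    rw [Finset.sum_ite_eq, if_pos (Finset.mem_range.2 (Nat.mod_lt _ hd))]
  simp only [h1]
  rw [← Finset.sum_const_zero (s := Finset.range d)]
  refine tendsto_finsetSum _ fun r hr => ?_
  have hr := Finset.mem_range.1 hr
  have hN : Tendsto (fun n => (n + (d - 1 - r)) / d) atTop atTop := by
    refine tendsto_atTop.2 fun b => ?_
    filter_upwards [eventually_ge_atTop (b * d)] with n hn
    exact (Nat.le_div_iff_mul_le hd).2 (by omega)
  -- Each class has at most `n` terms below `n`, so dividing by `n` instead of by their number only
  -- shrinks the average.
  refine squeeze_zero_norm' ?_ (tendsto_norm_zero.comp ((h r hr).comp hN))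
  filter_upwards [eventually_gt_atTop 0] with n hn
  simp only [Function.comp_apply]
  rcases Nat.eq_zero_or_pos ((n + (d - 1 - r)) / d) with h0 | hpos
  · simp [h0]
  · have hle : (n + (d - 1 - r)) / d ≤ n := by
      refine Nat.le_of_lt_succ ((Nat.div_lt_iff_lt_mul hd).2 ?_)
      have : n ≤ n * d := Nat.le_mul_of_pos_right n hd
      rw [Nat.succ_mul]; omega
    rw [norm_mul, norm_mul, norm_inv, norm_inv, Real.norm_natCast, Real.norm_natCast]
    exact mul_le_mul_of_nonneg_right
      (inv_anti₀ (Nat.cast_pos.2 hpos) (Nat.cast_le.2 hle)) (norm_nonneg _)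

variable {Ω : Type*} [MeasurableSpace Ω] {μ : Measure Ω} [IsProbabilityMeasure μ]

/-- Sample autocovariances of an i.i.d. centred square-integrable sequence. -/
theorem ae_tendsto_average_mul_lag {W : ℕ → Ω → ℝ} {s : ℝ} (hmeas : ∀ n, Measurable (W n))
    (hL2 : ∀ n, MemLp (W n) 2 μ) (hindep : iIndepFun W μ)
    (hident : ∀ n, IdentDistrib (W n) (W 0) μ μ) (hmean : ∀ n, ∫ ω, W n ω ∂μ = 0)
    (hvar : variance (W 0) μ = s) :
    ∀ᵐ ω ∂μ, ∀ h : ℕ, Tendsto (fun n : ℕ => (n : ℝ)⁻¹ *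
      ∑ k ∈ Finset.range n, W k ω * W (k + h) ω) atTop (𝓝 (if h = 0 then s else 0)) := by
  rw [ae_all_iff]
  intro h
  rcases Nat.eq_zero_or_pos h with rfl | hh
  · have hsq : ∫ ω, W 0 ω ^ 2 ∂μ = s := by
      rw [← variance_of_integral_eq_zero (hmeas 0).aemeasurable (hmean 0), hvar]
    have := strong_law_ae_real (fun n ω => W n ω ^ 2) (hL2 0).integrable_sq
      (fun i j hij => (hindep.indepFun hij).comp (φ := fun y => y ^ 2) (ψ := fun y => y ^ 2)
        (measurable_id.pow_const 2) (measurable_id.pow_const 2)) (fun n => (hident n).sq)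
    filter_upwards [this] with ω hω
    rw [hsq] at hω
    simpa only [add_zero, if_true, ← sq, div_eq_inv_mul] using hω
  -- Within a class modulo `h + 1` the index pairs `{k, k + h}` are disjoint, so the products are
  -- pairwise independent, which is all the strong law needs.
  · have key : ∀ r < h + 1, ∀ᵐ ω ∂μ, Tendsto (fun n : ℕ => (n : ℝ)⁻¹ *
        ∑ m ∈ Finset.range n, W (r + m * (h + 1)) ω * W (r + m * (h + 1) + h) ω) atTop (𝓝 0) := by
      intro r _
      have hne : ∀ a, a ≠ a + h := fun a => by omega
      have hint : ∀ a, Integrable (W a * W (a + h)) μ := fun a =>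
        (hindep.indepFun (hne a)).integrable_mul ((hL2 a).integrable (by norm_num))
          ((hL2 _).integrable (by norm_num))
      have hzero : ∀ a, ∫ ω, (W a * W (a + h)) ω ∂μ = 0 := fun a => by
        rw [(hindep.indepFun (hne a)).integral_mul_eq_mul_integral
          (hmeas a).aestronglyMeasurable (hmeas _).aestronglyMeasurable, hmean, zero_mul]
      have hid : ∀ a b, IdentDistrib (W a * W (a + h)) (W b * W (b + h)) μ μ := fun a b =>
        (IdentDistrib.prodMk ((hident a).trans (hident b).symm)
          ((hident (a + h)).trans (hident (b + h)).symm) (hindep.indepFun (hne a))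
          (hindep.indepFun (hne b))).comp measurable_mul
      have := strong_law_ae_real (fun m => W (r + m * (h + 1)) * W (r + m * (h + 1) + h))
        (hint _) (fun i j hij => ?_) (fun m => hid _ _)
      · filter_upwards [this] with ω hω
        rw [hzero] at hω
        simpa only [Pi.mul_apply, div_eq_inv_mul] using hω
      · have hij' : i * (h + 1) + (h + 1) ≤ j * (h + 1) ∨ j * (h + 1) + (h + 1) ≤ i * (h + 1) := by
          rcases lt_or_gt_of_ne hij with h' | h'
          · left; nlinarith
          · right; nlinarith
        exact hindep.indepFun_mul_mul hmeas _ _ _ _ (by omega) (by omega) (by omega) (by omega)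
    have hall := (ae_ball_iff (Set.to_countable {r | r < h + 1})).2 key
    filter_upwards [hall] with ω hω
    rw [if_neg (by omega)]
    exact tendsto_average_of_residues (w := fun k => W k ω * W (k + h) ω) (Nat.succ_pos h) hω

/-- Changing the first value of a sequence does not affect its limiting sample autocovariances. -/
theorem tendsto_average_mul_lag_cons {v : ℕ → ℝ} {h : ℕ} {L : ℝ}
    (hv : Tendsto (fun n : ℕ => (n : ℝ)⁻¹ *
      ∑ k ∈ Finset.range n, v (k + 1) * v (k + h + 1)) atTop (𝓝 L)) :
    Tendsto (fun n : ℕ => (n : ℝ)⁻¹ * ∑ k ∈ Finset.range n, v k * v (k + h)) atTop (𝓝 L) := by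
  have h1 := hv.add ((tendsto_inv_atTop_nhds_zero_nat (𝕜 := ℝ)).mul_const (v 0 * v h))
  rw [zero_mul, add_zero] at h1
  rw [← tendsto_add_atTop_iff_nat 1]
  have h2 : Tendsto (fun n : ℕ => (n : ℝ) / ((n : ℝ) + ((1 : ℕ) : ℝ))) atTop (𝓝 1) :=
    tendsto_natCast_div_add_atTop _
  have h3 := h2.mul h1
  rw [one_mul] at h3
  refine h3.congr' ?_
  filter_upwards [eventually_gt_atTop 0] with n hn
  have : (n : ℝ) ≠ 0 := by positivity
  rw [Finset.sum_range_succ', zero_add]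
  simp only [Nat.add_right_comm _ 1 h]
  push_cast
  field_simp

end DurbinWatson

theorem mainTheorem11 {Ω : Type*} [MeasurableSpace Ω] (μ : Measure Ω) [IsProbabilityMeasure μ]
    (p : ℕ) (hp : 1 ≤ p) (θ : Fin p → ℝ) (ρ σ : ℝ)
    (hθ0 : θ ≠ 0) (hθ1 : ∑ i, |θ i| < 1) (hρ : |ρ| < 1) (hσ : 0 < σ)
    (X : ℤ → Ω → ℝ) (ε V : ℕ → Ω → ℝ)
    (hX : DurbinWatson.IsARProcess θ ρ X ε V)
    (hX0_meas : Measurable (X 0)) (hX0 : MemLp (X 0) 2 μ)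
    (hV_meas : ∀ n, 1 ≤ n → Measurable (V n)) (hV_sq : ∀ n, 1 ≤ n → MemLp (V n) 2 μ)
    (hV_indep : iIndepFun (fun n : ℕ => V (n + 1)) μ)
    (hV_ident : ∀ n, 1 ≤ n → IdentDistrib (V n) (V 1) μ μ)
    (hV_mean : ∀ n, 1 ≤ n → ∫ ω, V n ω ∂μ = 0)
    (hV_var : ∀ n, 1 ≤ n → variance (V n) μ = σ ^ 2)
    (S : Matrix (Fin p) (Fin p) ℝ) (hS : S.PosDef)
    (hθstar : DurbinWatson.thetaStar hp θ ρ (DurbinWatson.lastIndex hp) ≠ 0) :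
    ∀ᵐ ω ∂μ,
      (∀ᶠ n : ℕ in atTop,
        ∑ k ∈ Finset.Icc 1 n, DurbinWatson.residual S (fun t => X t ω) n (k - 1) ^ 2 ≠ 0 ∧
        DurbinWatson.thetaHat S (fun t => X t ω) n (DurbinWatson.lastIndex hp) ≠ 0) ∧
      Tendsto (fun n : ℕ => DurbinWatson.sigmaSqHat hp S (fun t => X t ω) n) atTop
        (𝓝 (σ ^ 2)) := by
  have hcov := DurbinWatson.ae_tendsto_average_mul_lag (W := fun n => V (n + 1)) (s := σ ^ 2)
    (fun n => hV_meas _ (by omega)) (fun n => hV_sq _ (by omega)) hV_indep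
    (fun n => hV_ident _ (by omega)) (fun n => hV_mean _ (by omega)) (hV_var _ le_rfl)
  filter_upwards [hcov] with ω hω
  refine DurbinWatson.tendsto_sigmaSqHat_of_path hp hθ1 hρ (pow_ne_zero 2 hσ.ne')
    (x := fun t => X t ω) (e := fun n => ε n ω)
    -- `X_0` serves as the innovation at time 0; a single value does not affect limiting averages,
    -- whatever its law or dependence on `V`.
    (v := fun n => if n = 0 then X 0 ω else V n ω)
    (fun n hn => hX.ar_eq n hn ω) (fun n hn => ?_) (hX.init_zero ω) (if_pos rfl)
    (fun j h1 h2 => hX.init_neg j h1 h2 ω) (fun h => ?_) hθstar S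
  · rw [if_neg (by omega)]
    exact hX.noise_eq n hn ω
  · exact DurbinWatson.tendsto_average_mul_lag_cons (by simpa using hω h)
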